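/- Let $X$ be a finite non-empty set. A convex geometry with ground set $X$ is a family $P$ of subsets of $X$ such that (1) $\emptyset, X\in P$; (2) $A\cap B\in P$ whenever $A,B\in P$; and (3) for every $A\in P$ with $A\neq X$ there is $\alpha\in X\setminus A$ with $A\cup\{\alpha\}\in P$. Such a $P$ is regarded as a poset ordered by inclusion. The Dushnik–Miller dimension $\dim(P)$ is the least positive integer $t$ for which there are linear extensions $L_1,\dots,L_t$ of $P$ such that, for all $A,B\in P$, $A\subseteq B$ if and only if $A\le B$ in $L_i$ for every $i\in\{1,\dots,t\}$. The linear geometry of a linear order $\alpha_1<\dots<\alpha_n$ on $X$ consists of $\emptyset$ and the sets $\{\alpha_1,\dots,\alpha_i\}$, $1\le i\le n$. The convex dimension $\operatorname{cdim}(P)$ is the least positive integer $t$ for which there are linear geometries $P_1,\dots,P_t$ with ground set $X$ such that $P=\{A_1\cap\dots\cap A_t : A_i\in P_i \text{ for all } i\in\{1,\dots,t\}\}$. **Theorem.** If $P$ is a convex geometry and $\dim(P)\le 2$, then $\operatorname{cdim}(P)=\dim(P)$. -/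

import Mathlib

/-- A family `P` of subsets of the ground set `X` is a convex geometry. The ground set is the whole
type `X`; that it is finite and non-empty is assumed where the notion is used. -/
structure IsConvexGeometry {X : Type*} (P : Set (Set X)) : Prop where
  /-- Base property. -/
  empty_mem : ∅ ∈ P
  /-- Base property. -/
  univ_mem : Set.univ ∈ P
  /-- Intersection property. -/
  inter_mem : ∀ A ∈ P, ∀ B ∈ P, A ∩ B ∈ P
  /-- Extension property. -/
  exists_insert_mem : ∀ A ∈ P, A ≠ Set.univ → ∃ a, a ∉ A ∧ insert a A ∈ P

/-- `r` is (the non-strict relation of) a linear order on `X`. -/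
structure IsLinOrd {X : Type*} (r : X → X → Prop) : Prop where
  refl : ∀ x, r x x
  antisymm : ∀ x y, r x y → r y x → x = y
  trans : ∀ x y z, r x y → r y z → r x z
  total : ∀ x y, r x y ∨ r y x

/-- `r` is a linear extension of the poset `Q`. -/
def IsLinearExtension {Q : Type*} [PartialOrder Q] (r : Q → Q → Prop) : Prop :=
  IsLinOrd r ∧ ∀ x y : Q, x ≤ y → r x y

/-- The sequence `L` of relations is a realizer of the poset `Q`. -/
def IsRealizer {Q : Type*} [PartialOrder Q] {t : ℕ} (L : Fin t → Q → Q → Prop) : Prop :=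
  (∀ i, IsLinearExtension (L i)) ∧ ∀ x y : Q, x ≤ y ↔ ∀ i, L i x y

/-- The Dushnik-Miller dimension of the poset `Q`: the least positive integer `t` such that `Q` has
a realizer of size `t` (and `⊤` if `Q` has no finite realizer). -/
noncomputable def dmDim (Q : Type*) [PartialOrder Q] : ℕ∞ :=
  ⨅ t ∈ {t : ℕ | 1 ≤ t ∧ ∃ L : Fin t → Q → Q → Prop, IsRealizer L}, (t : ℕ∞)

/-- The family consisting of the empty set and the initial segments `{x | x ≤ a}` of the relation
`r` on `X`. -/
def initialSegments {X : Type*} (r : X → X → Prop) : Set (Set X) :=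
  {A | A = ∅ ∨ ∃ a, A = {x | r x a}}

/-- `P` is the linear geometry given by some linear order on `X`. -/
def IsLinearGeometry {X : Type*} (P : Set (Set X)) : Prop :=
  ∃ r : X → X → Prop, IsLinOrd r ∧ P = initialSegments r

/-- The join `P₁ ∨ ⋯ ∨ Pₜ = {A₁ ∩ ⋯ ∩ Aₜ | Aᵢ ∈ Pᵢ}` of families of subsets of `X`. -/
def geometryJoin {X : Type*} {t : ℕ} (P : Fin t → Set (Set X)) : Set (Set X) :=
  {A | ∃ B : Fin t → Set X, (∀ i, B i ∈ P i) ∧ A = ⋂ i, B i}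

/-- The sequence `L` of families is a convex realizer of `P`. -/
def IsConvexRealizer {X : Type*} {t : ℕ} (P : Set (Set X)) (L : Fin t → Set (Set X)) : Prop :=
  (∀ i, IsLinearGeometry (L i)) ∧ P = geometryJoin L

/-- The convex dimension of `P`: the least positive integer `t` such that `P` has a convex realizer
of size `t` (and `⊤` if there is none). -/
noncomputable def convexDim {X : Type*} (P : Set (Set X)) : ℕ∞ :=
  ⨅ t ∈ {t : ℕ | 1 ≤ t ∧ ∃ L : Fin t → Set (Set X), IsConvexRealizer P L}, (t : ℕ∞)

/-! Every member of P is the intersection of the copoints above it. Let linear extensions r, s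
realize P. A copoint M at x contains all its predecessors in r, or all those in s: otherwise some
member through x precedes M in r and another does in s (`IsCopoint.exists_mem_of_not_subset`); their
intersection precedes M in both, so it lies in M, yet it contains x. The members containing all
their r-predecessors form a chain, and likewise for s; extended to maximal chains of P, these become
linear geometries whose join is P.

Conversely, each linear geometry of a convex realizer preorders P totally by the least of its
members above A; breaking ties gives a realizer of the same size, so dim ≤ cdim always. -/

/-- `M` is a copoint of `P` attached to `x`: a maximal member of `P` that avoids `x`. -/
def IsCopoint {X : Type*} (P : Set (Set X)) (x : X) (M : Set X) : Prop :=
  Maximal (fun A => A ∈ P ∧ x ∉ A) M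

theorem exists_isCopoint_superset {X : Type*} [Finite X] {P : Set (Set X)} {A : Set X} {x : X}
    (hA : A ∈ P) (hx : x ∉ A) : ∃ M, A ⊆ M ∧ IsCopoint P x M :=
  (Set.toFinite {A : Set X | A ∈ P ∧ x ∉ A}).exists_le_maximal ⟨hA, hx⟩

/-- The point by which `M` extends must be `x`, or `M` would not be maximal. -/
theorem IsCopoint.insert_mem {X : Type*} {P : Set (Set X)} (hP : IsConvexGeometry P) {x : X}
    {M : Set X} (hM : IsCopoint P x M) : insert x M ∈ P := by
  have hne : M ≠ Set.univ := fun h => hM.prop.2 (h ▸ Set.mem_univ x)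
  obtain ⟨a, ha, haP⟩ := hP.exists_insert_mem M hM.prop.1 hne
  by_cases hxa : x = a
  · rwa [hxa]
  · have hx : x ∉ insert a M := by
      rintro (h | h)
      · exact hxa h
      · exact hM.prop.2 h
    exact absurd (hM.le_of_ge ⟨haP, hx⟩ (Set.subset_insert a M) (Set.mem_insert a M)) ha

/-- The extension property holds below every member of a convex geometry. -/
theorem IsConvexGeometry.exists_insert_mem_of_ssubset {X : Type*} [Finite X] {P : Set (Set X)}
    (hP : IsConvexGeometry P) {A B : Set X} (hA : A ∈ P) (hB : B ∈ P) (hAB : A ⊂ B) :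
    ∃ b ∈ B, b ∉ A ∧ insert b A ∈ P := by
  -- By maximality of `D`, the point that extends it lies in `B`; intersecting with `B` turns this
  -- into an extension of `A`.
  obtain ⟨D, -, hD⟩ := (Set.toFinite {D : Set X | D ∈ P ∧ D ∩ B = A}).exists_le_maximal
    ⟨hA, Set.inter_eq_left.2 hAB.subset⟩
  obtain ⟨hDP, hDB⟩ := hD.prop
  have hne : D ≠ Set.univ := by
    rintro rfl
    exact hAB.ne (by rw [← hDB, Set.univ_inter])
  obtain ⟨a, ha, haP⟩ := hP.exists_insert_mem D hDP hne
  by_cases haB : a ∈ B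
  · refine ⟨a, haB, fun h => ha (hDB ▸ h : a ∈ D ∩ B).1, ?_⟩
    rw [← hDB, ← Set.insert_inter_of_mem haB]
    exact hP.inter_mem _ haP _ hB
  · have h : insert a D ∈ P ∧ insert a D ∩ B = A :=
      ⟨haP, by rw [Set.insert_inter_of_notMem haB, hDB]⟩
    exact absurd (hD.le_of_ge h (Set.subset_insert a D) (Set.mem_insert a D)) ha

/-- A convex geometry that is a chain is a linear geometry. -/
theorem IsConvexGeometry.isLinearGeometry {X : Type*} [Finite X] {C : Set (Set X)}
    (hC : IsConvexGeometry C) (hchain : IsChain (· ⊆ ·) C) : IsLinearGeometry C := by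
  have key : ∀ x, ∃ M ∈ C, x ∉ M ∧ insert x M ∈ C := by
    intro x
    obtain ⟨M, -, hM⟩ := exists_isCopoint_superset hC.empty_mem (Set.notMem_empty x)
    exact ⟨M, hM.prop.1, hM.prop.2, hM.insert_mem hC⟩
  have segment : ∀ x, ∀ M ∈ C, x ∉ M → insert x M ∈ C →
      {y | ∀ A ∈ C, x ∈ A → y ∈ A} = insert x M := by
    intro x M hM hx hxM
    ext y
    refine ⟨fun h => h _ hxM (Set.mem_insert x M), ?_⟩
    rintro (rfl | hy) A hA hxA
    · exact hxA
    · rcases hchain.total hM hA with h | h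
      · exact h hy
      · exact absurd (h hxA) hx
  refine ⟨fun y x => ∀ A ∈ C, x ∈ A → y ∈ A, ⟨fun x A _ h => h, ?_, ?_, ?_⟩, ?_⟩
  · intro x y hxy hyx
    obtain ⟨M, hM, hx, hxM⟩ := key x
    rcases hyx _ hxM (Set.mem_insert x M) with h | h
    · exact h.symm
    · exact absurd (hxy M hM h) hx
  · exact fun x y z hxy hyz A hA hz => hxy A hA (hyz A hA hz)
  · intro x y
    by_contra! h
    obtain ⟨⟨A, hA, hyA, hxA⟩, B, hB, hxB, hyB⟩ := h
    rcases hchain.total hA hB with h | h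
    · exact hyB (h hyA)
    · exact hxA (h hxB)
  · ext A
    constructor
    · intro hA
      rcases A.eq_empty_or_nonempty with h | hne
      · exact Or.inl h
      · obtain ⟨B, -, hB⟩ := (Set.toFinite {B : Set X | B ∈ C ∧ B ⊂ A}).exists_le_maximal
          (show ∅ ∈ C ∧ ∅ ⊂ A from ⟨hC.empty_mem, Set.empty_ssubset.2 hne⟩)
        obtain ⟨x, hxA, hxB, hx⟩ :=
          hC.exists_insert_mem_of_ssubset hB.prop.1 hA hB.prop.2
        refine Or.inr ⟨x, ?_⟩
        rw [segment x B hB.prop.1 hxB hx]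
        by_contra hne'
        have h : insert x B ∈ C ∧ insert x B ⊂ A :=
          ⟨hx, (Set.insert_subset hxA hB.prop.2.subset).ssubset_of_ne (Ne.symm hne')⟩
        exact hxB (hB.le_of_ge h (Set.subset_insert x B) (Set.mem_insert x B))
    · rintro (rfl | ⟨x, rfl⟩)
      · exact hC.empty_mem
      · obtain ⟨M, hM, hx, hxM⟩ := key x
        rwa [segment x M hM hx hxM]

/-- Every chain of a convex geometry extends to a linear geometry inside it. -/
theorem IsConvexGeometry.exists_isLinearGeometry {X : Type*} [Finite X] {P C : Set (Set X)}
    (hP : IsConvexGeometry P) (hCP : C ⊆ P) (hC : IsChain (· ⊆ ·) C) :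
    ∃ D, C ⊆ D ∧ D ⊆ P ∧ IsChain (· ⊆ ·) D ∧ Set.univ ∈ D ∧ IsLinearGeometry D := by
  obtain ⟨D, hCD, hD⟩ := (Set.toFinite {D : Set (Set X) | D ⊆ P ∧ IsChain (· ⊆ ·) D}
    ).exists_le_maximal ⟨hCP, hC⟩
  obtain ⟨hDP, hDc⟩ := hD.prop
  have mem : ∀ A ∈ P, (∀ B ∈ D, A ⊆ B ∨ B ⊆ A) → A ∈ D := fun A hA h =>
    hD.le_of_ge ⟨Set.insert_subset hA hDP, hDc.insert fun B hB _ => h B hB⟩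
      (Set.subset_insert A D) (Set.mem_insert A D)
  have huniv : Set.univ ∈ D := mem _ hP.univ_mem fun B _ => Or.inr (Set.subset_univ B)
  refine ⟨D, hCD, hDP, hDc, huniv, IsConvexGeometry.isLinearGeometry
    ⟨mem _ hP.empty_mem fun B _ => Or.inl (Set.empty_subset B), huniv, ?_, ?_⟩ hDc⟩
  · intro A hA B hB
    rcases hDc.total hA hB with h | h
    · rwa [Set.inter_eq_left.2 h]
    · rwa [Set.inter_eq_right.2 h]
  · intro A hA hne
    -- `B` is the successor of `A` in the chain. A one-point extension of `A` inside `B` is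
    -- comparable with all of `D`, hence belongs to it.
    obtain ⟨B, -, hB⟩ := (Set.toFinite {B : Set X | B ∈ D ∧ A ⊂ B}).exists_le_minimal
      (show Set.univ ∈ D ∧ A ⊂ Set.univ from ⟨huniv, Set.ssubset_univ_iff.2 hne⟩)
    obtain ⟨b, hbB, hbA, hb⟩ :=
      hP.exists_insert_mem_of_ssubset (hDP hA) (hDP hB.prop.1) hB.prop.2
    refine ⟨b, hbA, mem _ hb fun E hE => ?_⟩
    rcases hDc.total hE hA with h | h
    · exact Or.inr (h.trans (Set.subset_insert b A))
    · rcases eq_or_ne A E with rfl | hAE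
      · exact Or.inr (Set.subset_insert b A)
      · left
        have hBE : B ⊆ E := by
          rcases hDc.total hB.prop.1 hE with h' | h'
          · exact h'
          · exact hB.le_of_le ⟨hE, h.ssubset_of_ne hAE⟩ h'
        exact Set.insert_subset (hBE hbB) h

/-- A member `N` that precedes the copoint `M` in the first of two linear extensions that realize
`P`, without being contained in `M`, yields such a member through the point of `M`. -/
theorem IsCopoint.exists_mem_of_not_subset {X : Type*} [Finite X] {P : Set (Set X)}
    (hP : IsConvexGeometry P) {r s : P → P → Prop} (hr : IsLinearExtension r)
    (hs : IsLinearExtension s) (hrs : ∀ A B : P, r A B → s A B → A ≤ B) {x : X} {M N : P}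
    (hM : IsCopoint P x M) (hNM : ¬ N ≤ M) (h : r N M) : ∃ G : P, x ∈ G.1 ∧ r G M := by
  by_cases hx : x ∈ N.1
  · exact ⟨N, hx, h⟩
  obtain ⟨K, hNK, hK⟩ := exists_isCopoint_superset N.2 hx
  refine ⟨⟨insert x K, hK.insert_mem hP⟩, Set.mem_insert x K, ?_⟩
  refine (hr.1.total _ _).resolve_right fun hrM => ?_
  -- If `M` were inside, then `M ⊆ K` as `x ∉ M`, so `K ⊆ M` by maximality and `N ⊆ K ⊆ M`.
  have hMK : ¬ M.1 ⊆ insert x K := fun hsub =>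
    hNM (hNK.trans (hM.le_of_ge hK.prop ((Set.subset_insert_iff_of_notMem hM.prop.2).1 hsub)))
  have hsM := (hs.1.total M ⟨insert x K, hK.insert_mem hP⟩).resolve_left fun hsM =>
    hMK (hrs _ _ hrM hsM)
  exact hNM (hrs _ _ h (hs.1.trans _ _ _ (hs.2 _ _ (hNK.trans (Set.subset_insert x K))) hsM))

/-- In a convex geometry realized by two linear extensions, each copoint contains all the members
that precede it in one of them. -/
theorem IsCopoint.forall_le_or_forall_le {X : Type*} [Finite X] {P : Set (Set X)}
    (hP : IsConvexGeometry P) {r s : P → P → Prop} (hr : IsLinearExtension r)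
    (hs : IsLinearExtension s) (hrs : ∀ A B : P, r A B → s A B → A ≤ B) {x : X} {M : P}
    (hM : IsCopoint P x M) : (∀ N, r N M → N ≤ M) ∨ ∀ N, s N M → N ≤ M := by
  by_contra! h
  obtain ⟨⟨N, hN, hNM⟩, N', hN', hNM'⟩ := h
  obtain ⟨G, hxG, hG⟩ := hM.exists_mem_of_not_subset hP hr hs hrs hNM hN
  obtain ⟨G', hxG', hG'⟩ := hM.exists_mem_of_not_subset hP hs hr
    (fun A B h h' => hrs A B h' h) hNM' hN'
  let F : P := ⟨G.1 ∩ G'.1, hP.inter_mem _ G.2 _ G'.2⟩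
  have hFM : F ≤ M := hrs F M (hr.1.trans _ _ _ (hr.2 F G Set.inter_subset_left) hG)
    (hs.1.trans _ _ _ (hs.2 F G' Set.inter_subset_right) hG')
  exact hM.prop.2 (hFM ⟨hxG, hxG'⟩)

/-- A linear extension `r` determines a linear geometry inside `P` that has among its members every
member of `P` containing all its predecessors in `r`. -/
theorem IsConvexGeometry.exists_isLinearGeometry_of_isLinearExtension {X : Type*} [Finite X]
    {P : Set (Set X)} (hP : IsConvexGeometry P) {r : P → P → Prop} (hr : IsLinearExtension r) :
    ∃ D, (∀ M : P, (∀ N, r N M → N ≤ M) → M.1 ∈ D) ∧ D ⊆ P ∧ IsChain (· ⊆ ·) D ∧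
      Set.univ ∈ D ∧ IsLinearGeometry D := by
  obtain ⟨D, hD, h⟩ := hP.exists_isLinearGeometry
    (C := Subtype.val '' {M : P | ∀ N, r N M → N ≤ M}) (by rintro _ ⟨M, -, rfl⟩; exact M.2) (by
      rintro _ ⟨M, hM, rfl⟩ _ ⟨N, hN, rfl⟩ -
      exact (hr.1.total M N).imp (hN M) (hM N))
  exact ⟨D, fun M hM => hD ⟨M, hM, rfl⟩, h⟩

theorem IsChain.exists_least_superset {X : Type*} [Finite X] {D : Set (Set X)}
    (hD : IsChain (· ⊆ ·) D) (huniv : Set.univ ∈ D) (A : Set X) :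
    ∃ B ∈ D, A ⊆ B ∧ ∀ M ∈ D, A ⊆ M → B ⊆ M := by
  obtain ⟨B, -, hB⟩ := (Set.toFinite {B : Set X | B ∈ D ∧ A ⊆ B}).exists_le_minimal
    (show Set.univ ∈ D ∧ A ⊆ Set.univ from ⟨huniv, Set.subset_univ A⟩)
  refine ⟨B, hB.prop.1, hB.prop.2, fun M hM hAM => ?_⟩
  rcases hD.total hB.prop.1 hM with h | h
  · exact h
  · exact hB.le_of_le ⟨hM, hAM⟩ h

theorem IsConvexGeometry.exists_isConvexRealizer_two {X : Type*} [Finite X] {P : Set (Set X)}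
    (hP : IsConvexGeometry P) {L : Fin 2 → P → P → Prop} (hL : IsRealizer L) :
    ∃ D : Fin 2 → Set (Set X), IsConvexRealizer P D := by
  have hrs : ∀ A B : P, L 0 A B → L 1 A B → A ≤ B := fun A B h h' =>
    (hL.2 A B).2 (Fin.forall_fin_two.2 ⟨h, h'⟩)
  choose D hD hDP hDc huniv hlin using fun i =>
    hP.exists_isLinearGeometry_of_isLinearExtension (hL.1 i)
  refine ⟨D, hlin, Set.Subset.antisymm ?_ ?_⟩
  · intro A hA
    -- A point outside `A` is missed by a copoint above `A`; that copoint lies in some `D i`, so it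
    -- contains `B i`.
    choose B hBD hAB hB using fun i => (hDc i).exists_least_superset (huniv i) A
    refine ⟨B, hBD, Set.Subset.antisymm (Set.subset_iInter hAB) fun x hx => ?_⟩
    rw [Set.mem_iInter] at hx
    by_contra hxA
    obtain ⟨M, hAM, hM⟩ := exists_isCopoint_superset hA hxA
    rcases IsCopoint.forall_le_or_forall_le (M := ⟨M, hM.prop.1⟩) hP (hL.1 0) (hL.1 1) hrs hM
      with h | h
    · exact hM.prop.2 (hB 0 M (hD 0 _ h) hAM (hx 0))
    · exact hM.prop.2 (hB 1 M (hD 1 _ h) hAM (hx 1))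
  · rintro _ ⟨B, hB, rfl⟩
    have h : ⋂ i, B i = B 0 ∩ B 1 := by
      ext x
      simp [Fin.forall_fin_two]
    rw [h]
    exact hP.inter_mem _ (hDP 0 (hB 0)) _ (hDP 1 (hB 1))

theorem IsConvexGeometry.exists_isConvexRealizer_one {X : Type*} [Finite X] {P : Set (Set X)}
    (hP : IsConvexGeometry P) {L : Fin 1 → P → P → Prop} (hL : IsRealizer L) :
    ∃ D : Fin 1 → Set (Set X), IsConvexRealizer P D := by
  have hle : ∀ A B : P, L 0 A B → A ≤ B := fun A B h =>
    (hL.2 A B).2 fun i => by rwa [Subsingleton.elim i 0]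
  have hchain : IsChain (· ⊆ ·) P := fun A hA B hB _ =>
    ((hL.1 0).1.total ⟨A, hA⟩ ⟨B, hB⟩).imp (hle _ _) (hle _ _)
  refine ⟨fun _ => P, fun _ => hP.isLinearGeometry hchain, Set.Subset.antisymm ?_ ?_⟩
  · exact fun A hA => ⟨fun _ => A, fun _ => hA, (Set.iInter_const A).symm⟩
  · rintro _ ⟨B, hB, rfl⟩
    have h : ⋂ i, B i = B 0 := by
      ext x
      simp
    rw [h]
    exact hB 0

theorem IsLinearGeometry.isChain {X : Type*} {C : Set (Set X)} (hC : IsLinearGeometry C) :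
    IsChain (· ⊆ ·) C := by
  obtain ⟨r, hr, rfl⟩ := hC
  rintro _ (rfl | ⟨a, rfl⟩) _ (rfl | ⟨b, rfl⟩) -
  · exact Or.inl (Set.empty_subset _)
  · exact Or.inl (Set.empty_subset _)
  · exact Or.inr (Set.empty_subset _)
  · exact (hr.total a b).imp (fun h x hx => hr.trans x a b hx h)
      (fun h x hx => hr.trans x b a hx h)

theorem exists_isLinearExtension (Q : Type*) [PartialOrder Q] :
    ∃ s : Q → Q → Prop, IsLinearExtension s := by
  let f : Q →o LinearExtension Q := toLinearExtension
  have hf : Function.Injective f := fun _ _ h => h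
  exact ⟨fun x y => f x ≤ f y, ⟨fun x => le_rfl, fun x y h h' => hf (le_antisymm h h'),
    fun x y z h h' => h.trans h', fun x y => le_total _ _⟩, fun x y h => f.monotone h⟩

/-- A total preorder that contains the order of `Q` refines to a linear extension of `Q`. -/
theorem exists_isLinearExtension_of_total {Q : Type*} [PartialOrder Q] {p : Q → Q → Prop}
    (hle : ∀ x y, x ≤ y → p x y) (htrans : ∀ x y z, p x y → p y z → p x z)
    (htotal : ∀ x y, p x y ∨ p y x) :
    ∃ r : Q → Q → Prop, IsLinearExtension r ∧ ∀ x y, r x y → p x y := by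
  obtain ⟨s, hs, hsle⟩ := exists_isLinearExtension Q
  -- Ties of `p` are broken by `s`.
  refine ⟨fun x y => p x y ∧ (p y x → s x y), ⟨⟨?_, ?_, ?_, ?_⟩, ?_⟩, fun x y h => h.1⟩
  · exact fun x => ⟨hle x x le_rfl, fun _ => hs.refl x⟩
  · exact fun x y h h' => hs.antisymm x y (h.2 h'.1) (h'.2 h.1)
  · exact fun x y z h h' => ⟨htrans x y z h.1 h'.1, fun hzx =>
      hs.trans x y z (h.2 (htrans y z x h'.1 hzx)) (h'.2 (htrans z x y hzx h.1))⟩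
  · intro x y
    by_cases h : p x y
    · by_cases h' : p y x
      · exact (hs.total x y).imp (fun k => ⟨h, fun _ => k⟩) (fun k => ⟨h', fun _ => k⟩)
      · exact Or.inl ⟨h, fun k => absurd k h'⟩
    · exact Or.inr ⟨(htotal x y).resolve_left h, fun k => absurd k h⟩
  · exact fun x y h => ⟨hle x y h, fun _ => hsle x y h⟩

theorem IsConvexRealizer.exists_isRealizer {X : Type*} {P : Set (Set X)} {t : ℕ}
    {D : Fin t → Set (Set X)} (hD : IsConvexRealizer P D) :
    ∃ L : Fin t → P → P → Prop, IsRealizer L := by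
  have h : ∀ i, ∃ r : P → P → Prop, IsLinearExtension r ∧
      ∀ A B, r A B → ∀ C ∈ D i, B.1 ⊆ C → A.1 ⊆ C := by
    intro i
    refine exists_isLinearExtension_of_total (fun A B h C _ hBC => Set.Subset.trans h hBC)
      (fun A B E h h' C hC hE => h C hC (h' C hC hE)) fun A B => ?_
    by_contra! h
    obtain ⟨⟨C, hC, hBC, hAC⟩, C', hC', hAC', hBC'⟩ := h
    rcases (hD.1 i).isChain.total hC hC' with h | h
    · exact hBC' (hBC.trans h)
    · exact hAC (hAC'.trans h)
  choose L hL hLD using h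
  refine ⟨L, hL, fun A B => ⟨fun h i => (hL i).2 A B h, fun h => ?_⟩⟩
  obtain ⟨C, hC, hBC⟩ : B.1 ∈ geometryJoin D := hD.2 ▸ B.2
  change A.1 ⊆ B.1
  rw [hBC]
  exact Set.subset_iInter fun i =>
    hLD i A B (h i) (C i) (hC i) (hBC.le.trans (Set.iInter_subset C i))

/-- A convex geometry, as a poset ordered by inclusion, of Dushnik-Miller dimension at most `2` has
convex dimension equal to its Dushnik-Miller dimension. -/
theorem theorem1p2 {X : Type*} [Finite X] [Nonempty X] (P : Set (Set X))
    (hP : IsConvexGeometry P) (hdim : dmDim ↥P ≤ 2) :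
    convexDim P = dmDim ↥P := by
  have upper : ∀ t : ℕ, (1 ≤ t ∧ ∃ L : Fin t → P → P → Prop, IsRealizer L) → t ≤ 2 →
      convexDim P ≤ t := by
    rintro t ⟨ht, L, hL⟩ ht2
    have hD : ∃ D : Fin t → Set (Set X), IsConvexRealizer P D := by
      interval_cases t
      · exact hP.exists_isConvexRealizer_one hL
      · exact hP.exists_isConvexRealizer_two hL
    exact iInf₂_le t ⟨ht, hD⟩
  -- A realizer of size at most 2 also settles the comparison with realizers of larger size.
  obtain ⟨s, hs, hs2⟩ : ∃ s : ℕ,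
      (1 ≤ s ∧ ∃ L : Fin s → P → P → Prop, IsRealizer L) ∧ s ≤ 2 := by
    by_contra! h
    have h3 : (3 : ℕ∞) ≤ dmDim ↥P := le_iInf₂ fun t ht => by exact_mod_cast h t ht
    exact absurd (h3.trans hdim) (by decide)
  refine le_antisymm (le_iInf₂ fun t ht => ?_) (le_iInf₂ fun t ht => ?_)
  · rcases le_total t 2 with h | h
    · exact upper t ht h
    · exact (upper s hs hs2).trans (by exact_mod_cast hs2.trans h)
  · obtain ⟨ht1, D, hD⟩ := ht
    exact iInf₂_le t ⟨ht1, hD.exists_isRealizer⟩
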